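/- Let $1<k<n$, let $A\in\mathbb C^{n\times n}$ be a Hermitian matrix and let $Q=[Q_1\ Q_2]\in\mathbb C^{n\times n}$ be a unitary matrix with $Q_1\in\mathbb C^{n\times k}$. Assume that for some reals $a\le b$ and $d>0$ the spectrum of $A_1=Q_1^HAQ_1$ lies in $(-\infty,a-d]\cup[b+d,\infty)$ and the spectrum of $A_2=Q_2^HAQ_2$ lies in $[a,b]$. Let $R=AQ_1-Q_1A_1$ and suppose that $\|R\|<\sqrt2\,d$, where $\|\cdot\|$ is the spectral norm (largest singular value). Put $\delta_R=\|R\|\tan\left(\frac12\arctan\frac{2\|R\|}{d}\right)$. Then $\delta_R<d$, and $A$ has $n$ orthonormal eigenvectors; any $n$ orthonormal eigenvectors of $A$ may be numbered in such an order that the corresponding unitary eigenvector matrix $X=[X_1\ X_2]$, $X_1\in\mathbb C^{n\times k}$, reduces $A$ to the diagonal form $X^HAX=\mathrm{diag}(\Lambda_1,\Lambda_2)$ with diagonal $\Lambda_1\in\mathbb C^{k\times k}$ having its spectrum in $(-\infty,a-d]\cup[b+d,\infty)$ and diagonal $\Lambda_2$ having its spectrum in $[a-\delta_R,b+\delta_R]$,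 and such that, moreover, the largest principal angle $\angle(\mathfrak Q_1,\mathfrak X_1)$ between the subspaces $\mathfrak Q_1$, $\mathfrak X_1$ of $\mathbb C^n$ spanned by the columns of $Q_1$ and of $X_1$, respectively, is less than $\pi/2$ and satisfies $$\tan\angle(\mathfrak Q_1,\mathfrak X_1)\le\frac{\|R\|}{d}.$$ -/

import Mathlib

open Matrix Module
open scoped Matrix.Norms.L2Operator

/-- The subspace of `ℂⁿ` (with its Euclidean structure) spanned by the columns of a matrix. -/
def columnSpan {n k : ℕ} (M : Matrix (Fin n) (Fin k) ℂ) :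
    Submodule ℂ (EuclideanSpace ℂ (Fin n)) :=
  Submodule.span ℂ (Set.range fun j : Fin k => WithLp.toLp 2 (M.col j))

/-- The principal (canonical) angles between two subspaces of `ℂⁿ`, in nondecreasing order:
for `i < min (dim F) (dim G)` the `i`-th one (counted from `0`) is the arccosine of the `i`-th
largest singular value of the orthogonal projection onto `G` restricted to `F`. -/
noncomputable def principalAngle {n : ℕ} (F G : Submodule ℂ (EuclideanSpace ℂ (Fin n)))
    (i : ℕ) : ℝ :=
  Real.arccos
    (LinearMap.singularValues (𝕜 := ℂ) (E := F) (F := G)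
      (G.orthogonalProjectionOnto.toLinearMap ∘ₗ F.subtype) i)

/-- The largest principal angle between two nonzero subspaces of `ℂⁿ`. -/
noncomputable def largestPrincipalAngle {n : ℕ}
    (F G : Submodule ℂ (EuclideanSpace ℂ (Fin n))) : ℝ :=
  principalAngle F G (min (finrank ℂ F) (finrank ℂ G) - 1)

open scoped InnerProductSpace

/-! Centre the interval: put c = (a+b)/2, r = (b-a)/2, M = A - c, P = Q₁Q₁ᴴ and V = ‖R‖. The block
of M on ran P is bounded below by r + d, the block on ker P is bounded by r, and the off-diagonal
blocks are bounded by V; `BlockBounds` records this. The number δ = δ_R is the nonnegative root of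
δ(δ+d) = V², so V² < 2d² forces δ < d. By `BlockBounds.abs_eigenvalue_le` no eigenvalue of M has
modulus strictly between r + δ and r + d, so the spectral projection E for the inner eigenvalues is
a continuous function of M.

The angle estimate ‖PE‖² ≤ V²/(d²+V²), the squared sine of arctan(V/d), comes from a vector
maximizing ‖Pf‖ over unit vectors of ran E (`BlockBounds.sq_mul_le_of_maximizer`), but only under
the a priori assumption ‖PE‖² ≤ 2/3. A homotopy removes the assumption: multiply the off-diagonal
blocks by t in [0,1]. The gap persists, E varies continuously from 1 - P, and V²/(d²+V²) < 2/3, so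
‖PE‖² can never cross 2/3. Along the same path the trace of E is a continuous integer, hence
constant, so exactly n - k eigenvalues are inner. Finally ‖PE‖ controls the distance from vectors of
ran P to ran(1 - E), which is the span of X₁. -/

/-! ### The scalar inequality behind the tangent bound. -/

/-- In the application κ is the tangent of the angle between a maximizing vector and ker P, and M,
L, U, W are normalized sizes of the four blocks of the operator on its two components. Since `h₂` is
an inequality it may only be multiplied by |κ² - 1|; the sign of κ² - 1 therefore decides which of p
and q can be eliminated with the help of `h₁`. -/
theorem mul_le_of_tangent_relations {κ r d V M L U W p q : ℝ} (hκ : 0 < κ) (hκ2 : κ ^ 2 ≤ 2)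
    (hr : 0 ≤ r) (hd : 0 < d) (hU : 0 ≤ U) (hW : 0 ≤ W) (hL : 0 ≤ L)
    (hM : r + d ≤ M) (hLr : L ≤ r) (hUV : U ≤ V) (hWV : W ≤ V)
    (hp : |p| ≤ M * U) (hq : |q| ≤ L * W)
    (h₁ : κ * (M ^ 2 - L ^ 2) = κ * (U ^ 2 - W ^ 2) + (κ ^ 2 - 1) * (p + q))
    (h₂ : U ^ 2 + 2 * κ * p + κ ^ 2 * M ^ 2 ≤
      κ ^ 2 * L ^ 2 + 2 * κ ^ 3 * q + κ ^ 4 * W ^ 2) :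
    κ * d ≤ V := by
  by_contra! hcon
  rcases le_or_gt κ 1 with h | h
  · have hκ' : κ ^ 2 ≤ 1 := by nlinarith
    -- The combination (1 - κ²)·`h₂` + 2κ³·`h₁` cancels q, and the common factor 1 + κ² divides out.
    have h5 : κ ^ 2 * (M ^ 2 - L ^ 2) ≤
        - κ ^ 4 * W ^ 2 + (2 * κ ^ 2 - 1) * U ^ 2 - 2 * κ * (1 - κ ^ 2) * p := by
      have key : (1 + κ ^ 2) * (κ ^ 2 * (M ^ 2 - L ^ 2)) ≤ (1 + κ ^ 2) *
        (- κ ^ 4 * W ^ 2 + (2 * κ ^ 2 - 1) * U ^ 2 - 2 * κ * (1 - κ ^ 2) * p) := by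
        have := mul_le_mul_of_nonneg_left h₂ (sub_nonneg.2 hκ')
        have e := congrArg (fun z => 2 * κ ^ 3 * z) h₁
        linarith
      exact le_of_mul_le_mul_left key (by positivity)
    have hp' : -(M * U) ≤ p := (abs_le.1 hp).1
    have h6 : 2 * κ * (1 - κ ^ 2) * (-(M * U)) ≤ 2 * κ * (1 - κ ^ 2) * p :=
      mul_le_mul_of_nonneg_left hp' (mul_nonneg (by positivity) (by linarith))
    have h7 : (κ * M - U) * (κ * M + (2 * κ ^ 2 - 1) * U) ≤ κ ^ 2 * L ^ 2 := by
      have : 0 ≤ κ ^ 4 * W ^ 2 := by positivity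
      nlinarith
    have h8 : κ * r < κ * M - U := by nlinarith
    have h9 : κ * r < κ * M + (2 * κ ^ 2 - 1) * U := by nlinarith [mul_nonneg (sq_nonneg κ) hU]
    have h10 : (κ * r) * (κ * r) < (κ * M - U) * (κ * M + (2 * κ ^ 2 - 1) * U) :=
      mul_lt_mul'' h8 h9 (by positivity) (by positivity)
    have h11 : κ ^ 2 * L ^ 2 ≤ (κ * r) * (κ * r) := by
      have : L ^ 2 ≤ r ^ 2 := by gcongr
      nlinarith [sq_nonneg κ]
    linarith
  · have hκ' : 0 < κ ^ 2 - 1 := by nlinarith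
    -- Now (κ² - 1)·`h₂` and 2κ·`h₁` cancel p instead.
    have h4 : κ ^ 2 * (M ^ 2 - L ^ 2) ≤
        κ ^ 2 * (κ ^ 2 - 2) * W ^ 2 + U ^ 2 + 2 * κ * (κ ^ 2 - 1) * q := by
      have key : (1 + κ ^ 2) * (κ ^ 2 * (M ^ 2 - L ^ 2)) ≤ (1 + κ ^ 2) *
          (κ ^ 2 * (κ ^ 2 - 2) * W ^ 2 + U ^ 2 + 2 * κ * (κ ^ 2 - 1) * q) := by
        have := mul_le_mul_of_nonneg_left h₂ hκ'.le
        have e := congrArg (fun z => 2 * κ * z) h₁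
        linarith
      exact le_of_mul_le_mul_left key (by positivity)
    have hq' : q ≤ r * W := (abs_le.1 hq).2.trans (by gcongr)
    have h6 : 2 * κ * (κ ^ 2 - 1) * q ≤ 2 * κ * (κ ^ 2 - 1) * (r * W) :=
      mul_le_mul_of_nonneg_left hq' (by positivity)
    -- The threshold κ² ≤ 2 enters here and in `h12`, as κ² - 1 ≤ 1.
    have h7 : κ ^ 2 * (κ ^ 2 - 2) * W ^ 2 ≤ 0 := by
      have : 0 ≤ κ ^ 2 * W ^ 2 := by positivity
      nlinarith
    have h8 : κ ^ 2 * (r + d) ^ 2 ≤ κ ^ 2 * M ^ 2 := by gcongr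
    have h9 : κ ^ 2 * L ^ 2 ≤ κ ^ 2 * r ^ 2 := by gcongr
    have h10 : U ^ 2 < (κ * d) ^ 2 := by
      have : U < κ * d := by linarith
      gcongr
    have h11 : κ ^ 2 * (2 * r * d) < 2 * κ * (κ ^ 2 - 1) * (r * W) := by nlinarith
    have h12 : 2 * κ * (κ ^ 2 - 1) * (r * W) ≤ 2 * κ * 1 * (r * (κ * d)) := by
      have : W ≤ κ * d := by linarith
      gcongr
      linarith
    nlinarith

/-! ### Operators with block bounds: the spectral gap and the a priori angle bound. -/

section

variable {H : Type*} [NormedAddCommGroup H] [InnerProductSpace ℂ H]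

theorem norm_add_sq_of_map_eq {P : H →L[ℂ] H} (hP : ∀ x y, ⟪P x, y⟫_ℂ = ⟪x, P y⟫_ℂ)
    {x y : H} (hx : P x = x) (hy : P y = 0) : ‖x + y‖ ^ 2 = ‖x‖ ^ 2 + ‖y‖ ^ 2 := by
  have : ⟪x, y⟫_ℂ = 0 := by rw [← hx, hP, hy, inner_zero_right]
  rw [@norm_add_sq ℂ, this]; simp

/-- `P` is an orthogonal projection and `T` a symmetric operator whose diagonal block on `ran P` is
bounded below by `r + d`, whose block on `ker P` is bounded by `r`, and whose off-diagonal blocks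
are bounded by `V`. -/
structure BlockBounds (T P : H →L[ℂ] H) (r d V : ℝ) : Prop where
  symm : ∀ x y, ⟪T x, y⟫_ℂ = ⟪x, T y⟫_ℂ
  proj_symm : ∀ x y, ⟪P x, y⟫_ℂ = ⟪x, P y⟫_ℂ
  proj_idem : ∀ x, P (P x) = P x
  outer : ∀ x, P x = x → (r + d) * ‖x‖ ≤ ‖P (T x)‖
  inner : ∀ y, P y = 0 → ‖T y - P (T y)‖ ≤ r * ‖y‖
  offDiag : ∀ x, P x = x → ‖T x - P (T x)‖ ≤ V * ‖x‖
  offDiag' : ∀ y, P y = 0 → ‖P (T y)‖ ≤ V * ‖y‖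

theorem BlockBounds.neg {T P : H →L[ℂ] H} {r d V : ℝ} (h : BlockBounds T P r d V) :
    BlockBounds (-T) P r d V where
  symm x y := by simp [h.symm]
  proj_symm := h.proj_symm
  proj_idem := h.proj_idem
  outer x hx := by simpa using h.outer x hx
  inner y hy := by
    have := h.inner y hy
    rw [← norm_neg] at this
    simpa [sub_eq_add_neg, add_comm] using this
  offDiag x hx := by
    have := h.offDiag x hx
    rw [← norm_neg] at this
    simpa [sub_eq_add_neg, add_comm] using this
  offDiag' y hy := by simpa using h.offDiag' y hy

/-- Split v = x + y along P. Testing the eigenvalue equation against y bounds Re⟨x, PTy⟩ below by (μ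
- r)‖y‖²; its ran P component together with the outer bound gives (μ + r + d) Re⟨x, PTy⟩ ≤ ‖PTy‖² ≤
V²‖y‖². Hence (μ - r)(μ + r + d) ≤ V², which fails for μ > r + δ. -/
theorem BlockBounds.eigenvalue_le {T P : H →L[ℂ] H} {r d V δ μ : ℝ} (h : BlockBounds T P r d V)
    (hr : 0 ≤ r) (hd : 0 < d) (hδ : 0 ≤ δ) (hVδ : V ^ 2 ≤ δ * (δ + d)) {v : H}
    (hv : v ≠ 0) (hTv : T v = (μ : ℂ) • v) (hμ : |μ| < r + d) : μ ≤ r + δ := by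
  by_contra! hcon
  have hμ' : μ < r + d := (abs_lt.1 hμ).2
  set x := P v with hx
  set y := v - P v with hy
  have hPx : P x = x := h.proj_idem v
  have hPy : P y = 0 := by simp [hy, h.proj_idem]
  have hxy : x + y = v := by simp [hx, hy]
  set a := P (T x) with ha
  set b := P (T y) with hb
  have hab : a + b = (μ : ℂ) • x := by
    rw [ha, hb, ← map_add, ← map_add, hxy, hTv, map_smul]
  have e1 : ∀ (t : ℝ) (z : ℂ), RCLike.re ((t : ℂ) * z) = t * RCLike.re z :=
    fun t z => RCLike.re_ofReal_mul t z
  have n1 := h.outer x hPx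
  have n2 := h.inner y hPy
  have n4 := h.offDiag' y hPy
  set q := RCLike.re ⟪x, b⟫_ℂ with hq
  have hqX : q ≤ ‖x‖ * ‖b‖ := re_inner_le_norm _ _
  have hasq : ‖a‖ ^ 2 = μ ^ 2 * ‖x‖ ^ 2 - 2 * μ * q + ‖b‖ ^ 2 := by
    rw [eq_sub_of_add_eq hab, @norm_sub_sq ℂ, inner_smul_left, norm_smul, Complex.conj_ofReal, e1,
      Complex.norm_real, mul_pow, Real.norm_eq_abs, sq_abs]
    ring
  have hqY : (μ - r) * ‖y‖ ^ 2 ≤ q := by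
    have h1 : RCLike.re ⟪y, T v⟫_ℂ = μ * ‖y‖ ^ 2 := by
      have h0 : ⟪y, x⟫_ℂ = 0 := by rw [← hPx, ← h.proj_symm, hPy, inner_zero_left]
      rw [hTv, inner_smul_right, e1, ← hxy, inner_add_right, h0, zero_add,
        inner_self_eq_norm_sq]
    have h2 : RCLike.re ⟪y, T x⟫_ℂ = q := by
      rw [inner_re_symm, h.symm, hq, hb, ← h.proj_symm, hPx]
    have h3 : RCLike.re ⟪y, T y⟫_ℂ ≤ r * ‖y‖ ^ 2 := by
      have : ⟪y, T y⟫_ℂ = ⟪y, T y - P (T y)⟫_ℂ := by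
        rw [inner_sub_right, ← h.proj_symm, hPy, inner_zero_left, sub_zero]
      rw [this]
      calc _ ≤ ‖y‖ * ‖T y - P (T y)‖ := re_inner_le_norm _ _
        _ ≤ ‖y‖ * (r * ‖y‖) := by gcongr
        _ = _ := by ring
    rw [← hxy, map_add, inner_add_right, map_add, h2] at h1
    linarith
  have hy0 : 0 < ‖y‖ := by
    rcases (norm_nonneg y).eq_or_lt with h0 | h0
    · have hy0 : y = 0 := norm_eq_zero.1 h0.symm
      have hxv : x = v := by rw [← hxy, hy0, add_zero]
      have hx0 : 0 < ‖x‖ := by rw [hxv]; exact norm_pos_iff.2 hv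
      have hb0 : b = 0 := by rw [hb, hy0, map_zero, map_zero]
      rw [hb0, add_zero] at hab
      rw [← ha, hab, norm_smul, Complex.norm_real, Real.norm_eq_abs] at n1
      exact absurd (le_of_mul_le_mul_right n1 hx0) (not_le.2 hμ)
    · exact h0
  have hY2 : 0 < ‖y‖ ^ 2 := by positivity
  have hq0 : 0 < q := lt_of_lt_of_le (mul_pos (by linarith) hY2) hqY
  have hu : 0 ≤ ‖b‖ ^ 2 := by positivity
  have m1 : ((r + d) * ‖x‖) ^ 2 ≤ ‖a‖ ^ 2 := by gcongr
  have m2 : q ^ 2 ≤ (‖x‖ * ‖b‖) ^ 2 := by gcongr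
  have m4 : ‖b‖ ^ 2 ≤ (V * ‖y‖) ^ 2 := by gcongr
  -- With u = ‖b‖², the outer bound multiplied by u and Cauchy–Schwarz for q give u² - 2μqu -
  -- ((r+d)² - μ²)q² ≥ 0, and this quadratic form factors.
  have m5 : 0 ≤ (‖b‖ ^ 2 - (μ + r + d) * q) * (‖b‖ ^ 2 + (r + d - μ) * q) := by
    have k1 : ((r + d) ^ 2 - μ ^ 2) * q ^ 2 ≤ ((r + d) ^ 2 - μ ^ 2) * (‖x‖ * ‖b‖) ^ 2 := by
      refine mul_le_mul_of_nonneg_left m2 ?_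
      nlinarith
    have k2 : (((r + d) ^ 2 - μ ^ 2) * ‖x‖ ^ 2 + 2 * μ * q) * ‖b‖ ^ 2 ≤ ‖b‖ ^ 2 * ‖b‖ ^ 2 := by
      refine mul_le_mul_of_nonneg_right ?_ hu
      linarith
    linarith
  have m6 : 0 ≤ ‖b‖ ^ 2 - (μ + r + d) * q := by
    refine nonneg_of_mul_nonneg_left m5 ?_
    have : 0 < (r + d - μ) * q := mul_pos (by linarith) hq0
    linarith
  have m7 : (μ + r + d) * ((μ - r) * ‖y‖ ^ 2) ≤ (μ + r + d) * q :=
    mul_le_mul_of_nonneg_left hqY (by linarith)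
  have m8 : (μ + r + d) * (μ - r) * ‖y‖ ^ 2 ≤ V ^ 2 * ‖y‖ ^ 2 := by nlinarith
  have m9 := le_of_mul_le_mul_right m8 hY2
  have m10 : δ * (δ + d) < (μ - r) * (μ + r + d) :=
    mul_lt_mul'' (by linarith) (by linarith) hδ (by linarith)
  linarith

theorem BlockBounds.abs_eigenvalue_le {T P : H →L[ℂ] H} {r d V δ μ : ℝ}
    (h : BlockBounds T P r d V)
    (hr : 0 ≤ r) (hd : 0 < d) (hδ : 0 ≤ δ) (hVδ : V ^ 2 ≤ δ * (δ + d)) {v : H}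
    (hv : v ≠ 0) (hTv : T v = (μ : ℂ) • v) (hμ : |μ| < r + d) : |μ| ≤ r + δ :=
  abs_le'.2 ⟨h.eigenvalue_le hr hd hδ hVδ hv hTv hμ,
    h.neg.eigenvalue_le hr hd hδ hVδ hv (by simp [hTv]) (by rwa [abs_neg])⟩

/-- The subtracted bracket is the off-diagonal part PT(1-P) + (1-P)TP, so the diagonal blocks stay
fixed and the off-diagonal ones are multiplied by t. -/
theorem BlockBounds.scale {T P : H →L[ℂ] H} {r d V t : ℝ} (h : BlockBounds T P r d V)
    (ht : 0 ≤ t) (ht1 : t ≤ 1) :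
    BlockBounds (T - ((1 - t : ℝ) : ℂ) • (P * T + T * P - (2 : ℂ) • (P * T * P))) P r d V := by
  set S := T - ((1 - t : ℝ) : ℂ) • (P * T + T * P - (2 : ℂ) • (P * T * P)) with hS
  have hSz : ∀ z, S z = T z - ((1 - t : ℝ) : ℂ) •
      (P (T z) + T (P z) - (2 : ℂ) • P (T (P z))) := fun z => rfl
  have hSx : ∀ x, P x = x → S x = P (T x) + (t : ℂ) • (T x - P (T x)) := by
    intro x hx
    simp only [hSz, hx]
    push_cast; module
  have hSy : ∀ y, P y = 0 → S y = (T y - P (T y)) + (t : ℂ) • P (T y) := by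
    intro x hx
    simp only [hSz, hx, map_zero]
    push_cast; module
  have hnt : ‖(t : ℂ)‖ ≤ 1 := by
    rw [Complex.norm_real, Real.norm_eq_abs, abs_of_nonneg ht]; exact ht1
  refine ⟨fun x y => ?_, h.proj_symm, h.proj_idem, fun x hx => ?_, fun y hy => ?_, fun x hx => ?_,
    fun y hy => ?_⟩
  · simp only [hSz, inner_sub_left,
      inner_sub_right, inner_add_left, inner_add_right, inner_smul_left, inner_smul_right,
      h.symm, h.proj_symm, Complex.conj_ofReal, map_ofNat]
    ring
  · rw [hSx x hx]
    simpa [h.proj_idem] using h.outer x hx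
  · rw [hSy y hy]
    simpa [h.proj_idem] using h.inner y hy
  · rw [hSx x hx]
    simp only [map_add, h.proj_idem, map_smul, map_sub, sub_self, smul_zero, add_zero,
      add_sub_cancel_left, norm_smul]
    exact (mul_le_of_le_one_left (norm_nonneg _) hnt).trans (h.offDiag x hx)
  · rw [hSy y hy]
    simp only [map_add, h.proj_idem, map_smul, map_sub, sub_self, zero_add, norm_smul]
    exact (mul_le_of_le_one_left (norm_nonneg _) hnt).trans (h.offDiag' y hy)

/-- If `f` maximizes `‖P f‖` over the unit sphere of the range of the projection `E`, then
`E (P f) = ‖P f‖² f`. -/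
theorem proj_apply_of_maximizer {P E : H →L[ℂ] H}
    (hP : ∀ x y, ⟪P x, y⟫_ℂ = ⟪x, P y⟫_ℂ) (hPP : ∀ x, P (P x) = P x)
    (hE : ∀ x y, ⟪E x, y⟫_ℂ = ⟪x, E y⟫_ℂ) (hEE : ∀ x, E (E x) = E x)
    {s : ℝ} (hs : 0 ≤ s) (hmax : ∀ z, E z = z → ‖P z‖ ≤ s * ‖z‖) {f : H} (hf : E f = f)
    (hf1 : ‖f‖ = 1) (hfs : ‖P f‖ = s) : E (P f) = ((s ^ 2 : ℝ) : ℂ) • f := by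
  have key : RCLike.re ⟪E (P f), f⟫_ℂ = s ^ 2 := by
    rw [hE, hf, ← hPP, hP, ← hfs, inner_self_eq_norm_sq (𝕜 := ℂ)]
  have hle : ‖E (P f)‖ ≤ s ^ 2 := by
    have h1 : ‖E (P f)‖ ^ 2 ≤ s ^ 2 * ‖E (P f)‖ := by
      rw [← inner_self_eq_norm_sq (𝕜 := ℂ), hE, hEE, ← hPP, hP, hPP]
      calc _ ≤ ‖P f‖ * ‖P (E (P f))‖ := re_inner_le_norm _ _
        _ ≤ s * (s * ‖E (P f)‖) := by
          rw [hfs]; gcongr; exact hmax _ (hEE _)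
        _ = _ := by ring
    rcases (norm_nonneg (E (P f))).eq_or_lt with h0 | h0
    · rw [← h0]; positivity
    · rw [sq] at h1; exact le_of_mul_le_mul_right h1 h0
  -- Expanding ‖E(Pf) - s²f‖² gives at most s⁴ - 2s⁴ + s⁴.
  rw [← sub_eq_zero, ← norm_eq_zero, ← sq_eq_zero_iff]
  refine le_antisymm ?_ (sq_nonneg _)
  have hre : RCLike.re (((s ^ 2 : ℝ) : ℂ) * ⟪E (P f), f⟫_ℂ) = s ^ 2 * s ^ 2 := by
    rw [← key]; exact RCLike.re_ofReal_mul _ _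
  rw [@norm_sub_sq ℂ, inner_smul_right, norm_smul, hf1, hre]
  have : ‖E (P f)‖ ^ 2 ≤ (s ^ 2) ^ 2 := by gcongr
  simp only [Complex.norm_real, Real.norm_eq_abs, abs_of_nonneg (sq_nonneg s)]
  nlinarith

/-- A-priori tangent bound for a spectral projection `E` of `T` whose range is already known to
make a moderate angle with the kernel of `P`. -/
theorem BlockBounds.sq_mul_le_of_maximizer {T P E : H →L[ℂ] H} {r d V : ℝ}
    (h : BlockBounds T P r d V) (hE : ∀ x y, ⟪E x, y⟫_ℂ = ⟪x, E y⟫_ℂ) (hEE : ∀ x, E (E x) = E x)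
    (hTE : ∀ x, T (E x) = E (T x)) (hr : 0 ≤ r) (hd : 0 < d)
    {s : ℝ} (hs : 0 ≤ s) (hs2 : s ^ 2 ≤ 2 / 3)
    (hmax : ∀ z, E z = z → ‖P z‖ ≤ s * ‖z‖) {f : H} (hf : E f = f)
    (hf1 : ‖f‖ = 1) (hfs : ‖P f‖ = s) : s ^ 2 * (d ^ 2 + V ^ 2) ≤ V ^ 2 := by
  obtain ⟨hT, hP, hPP, h₁, h₂, h₃, h₄⟩ := h
  rcases hs.eq_or_lt with rfl | hs0
  · simp; positivity
  have hEP := proj_apply_of_maximizer hP hPP hE hEE hs hmax hf hf1 hfs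
  set x := P f with hx
  set y := f - P f with hy
  have hPx : P x = x := hPP f
  have hPy : P y = 0 := by simp [hy, hPP]
  have hxy : x + y = f := by simp [hx, hy]
  set c := ‖y‖ with hc
  have hcs : s ^ 2 + c ^ 2 = 1 := by
    have := norm_add_sq_of_map_eq hP hPx hPy
    rw [hxy, hf1, hfs] at this; linarith
  have hc0 : 0 < c := by
    have : 0 ≤ c := norm_nonneg _
    rcases this.eq_or_lt with h | h
    · rw [← h] at hcs; nlinarith
    · exact h
  set a := P (T x) with ha
  set b := P (T y) with hb
  set p := T x - P (T x) with hp
  set e := T y - P (T y) with he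
  have hPa : P a = a := hPP _
  have hPb : P b = b := hPP _
  have hPp : P p = 0 := by simp [hp, hPP]
  have hPe : P e = 0 := by simp [he, hPP]
  have hTx : T x = a + p := by simp [ha, hp]
  have hTy : T y = b + e := by simp [hb, he]
  -- the two components of `T f`
  have hETf : E (T f) = T f := by rw [← hTE, hf]
  have hTf : T f = (a + b) + (p + e) := by rw [← hxy, map_add, hTx, hTy]; abel
  -- T f lies in ran E again, so maximality applies to it as well.
  have hin2 : c ^ 2 * ‖a + b‖ ^ 2 ≤ s ^ 2 * ‖p + e‖ ^ 2 := by
    have h := hmax _ hETf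
    have hPTf : P (T f) = a + b := by rw [hTf]; simp [hPa, hPb, hPp, hPe]
    rw [hPTf] at h
    have h' : ‖a + b‖ ^ 2 ≤ s ^ 2 * ‖T f‖ ^ 2 := by rw [← mul_pow]; gcongr
    rw [hTf, norm_add_sq_of_map_eq hP (x := a + b) (y := p + e) (by simp [hPa, hPb])
      (by simp [hPp, hPe])] at h'
    nlinarith
  -- This is x - s²f, which E kills because E x = s²f. Hence T g is in ker E, orthogonal to T f in
  -- ran E.
  set g := ((c ^ 2 : ℝ) : ℂ) • x - ((s ^ 2 : ℝ) : ℂ) • y with hg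
  have hgE : E g = 0 := by
    have : g = x - ((s ^ 2 : ℝ) : ℂ) • f := by
      have hc2 : c ^ 2 = 1 - s ^ 2 := by linarith
      rw [hg, ← hxy, hc2]; push_cast; module
    rw [this, map_sub, map_smul, hf, hEP, sub_self]
  have horth : ⟪T f, T g⟫_ℂ = 0 := by
    rw [← hETf, hE, ← hTE, hgE, map_zero, inner_zero_right]
  have o1 : ∀ z w, P z = z → P w = 0 → ⟪z, w⟫_ℂ = 0 := fun z w hz hw => by
    rw [← hz, hP, hw, inner_zero_right]
  have o2 : ∀ z w, P z = z → P w = 0 → ⟪w, z⟫_ℂ = 0 := fun z w hz hw => by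
    rw [← hz, ← hP, hw, inner_zero_left]
  have hin1 : c ^ 2 * ‖a‖ ^ 2 - s ^ 2 * ‖b‖ ^ 2 + c ^ 2 * ‖p‖ ^ 2 - s ^ 2 * ‖e‖ ^ 2 +
      (c ^ 2 - s ^ 2) * (RCLike.re ⟪a, b⟫_ℂ + RCLike.re ⟪p, e⟫_ℂ) = 0 := by
    have h := congrArg (RCLike.re : ℂ → ℝ) horth
    rw [hTf, hg, map_sub, map_smul, map_smul, hTx, hTy] at h
    simp only [inner_add_left, inner_sub_right, inner_smul_right, inner_add_right, o1 a p hPa hPp,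
      o1 a e hPa hPe, o1 b p hPb hPp, o1 b e hPb hPe, o2 a p hPa hPp, o2 a e hPa hPe,
      o2 b p hPb hPp, o2 b e hPb hPe, add_zero, zero_add, mul_add, map_add, map_sub, map_zero] at h
    have h3 : RCLike.re ⟪b, a⟫_ℂ = RCLike.re ⟪a, b⟫_ℂ := inner_re_symm _ _
    have h4 : RCLike.re ⟪e, p⟫_ℂ = RCLike.re ⟪p, e⟫_ℂ := inner_re_symm _ _
    have e1 : ∀ (t : ℝ) (z : ℂ), RCLike.re ((t : ℂ) * z) = t * RCLike.re z :=
      fun t z => RCLike.re_ofReal_mul t z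
    simp only [e1, inner_self_eq_norm_sq, h3, h4] at h
    linarith
  rw [@norm_add_sq ℂ, @norm_add_sq ℂ] at hin2
  have n1 := h₁ x hPx
  have n2 := h₂ y hPy
  have n3 := h₃ x hPx
  have n4 := h₄ y hPy
  rw [hfs] at n1 n3
  have cP : |RCLike.re ⟪a, b⟫_ℂ| ≤ ‖a‖ * ‖b‖ :=
    (RCLike.abs_re_le_norm _).trans (norm_inner_le_norm _ _)
  have cQ : |RCLike.re ⟪p, e⟫_ℂ| ≤ ‖e‖ * ‖p‖ :=
    (RCLike.abs_re_le_norm _).trans ((norm_inner_le_norm _ _).trans_eq (mul_comm _ _))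
  -- Dividing by ‖x‖ = s and ‖y‖ = c turns the orthogonality into `h₁` and the maximality into `h₂`;
  -- s² ≤ 2/3 becomes κ² ≤ 2.
  have hres := mul_le_of_tangent_relations (κ := s / c) (r := r) (d := d) (V := V)
    (M := ‖a‖ / s) (L := ‖e‖ / c) (U := ‖b‖ / c) (W := ‖p‖ / s)
    (p := RCLike.re ⟪a, b⟫_ℂ / (s * c)) (q := RCLike.re ⟪p, e⟫_ℂ / (s * c))
    (by positivity) (by rw [div_pow, div_le_iff₀ (by positivity)]; linarith) hr hd
    (by positivity) (by positivity) (by positivity) (by rwa [le_div_iff₀ hs0])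
    (by rwa [div_le_iff₀ hc0]) (by rwa [div_le_iff₀ hc0]) (by rwa [div_le_iff₀ hs0])
    (by rw [abs_div, abs_of_pos (mul_pos hs0 hc0), div_mul_div_comm]; gcongr)
    (by rw [abs_div, abs_of_pos (mul_pos hs0 hc0), div_mul_div_comm, mul_comm c s]; gcongr)
    (by field_simp; linarith)
    (by
      field_simp
      linarith)
  rw [div_mul_eq_mul_div, div_le_iff₀ hc0] at hres
  have : (s * d) ^ 2 ≤ (V * c) ^ 2 := by gcongr
  have hc2 : c ^ 2 = 1 - s ^ 2 := by linarith
  rw [mul_pow, mul_pow, hc2] at this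
  linarith

/-- In finite dimension the maximizer exists, so the bound holds for the norm of `P E`. -/
theorem BlockBounds.norm_sq_mul_le [FiniteDimensional ℂ H] {T P E : H →L[ℂ] H} {r d V : ℝ}
    (h : BlockBounds T P r d V) (hE : ∀ x y, ⟪E x, y⟫_ℂ = ⟪x, E y⟫_ℂ) (hEE : ∀ x, E (E x) = E x)
    (hTE : ∀ x, T (E x) = E (T x)) (hr : 0 ≤ r) (hd : 0 < d)
    (hs2 : ‖P * E‖ ^ 2 ≤ 2 / 3) : ‖P * E‖ ^ 2 * (d ^ 2 + V ^ 2) ≤ V ^ 2 := by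
  rcases (norm_nonneg (P * E)).eq_or_lt with h0 | h0
  · rw [← h0]; simp; positivity
  have hmax : ∀ z, E z = z → ‖P z‖ ≤ ‖P * E‖ * ‖z‖ := fun z hz => by
    simpa [hz] using (P * E).le_opNorm z
  have hcontr : ∀ z, ‖E z‖ ≤ ‖z‖ := fun z => by
    have h1 : ‖E z‖ * ‖E z‖ ≤ ‖z‖ * ‖E z‖ := by
      rw [← inner_self_eq_norm_mul_norm (𝕜 := ℂ), hE, hEE]
      exact re_inner_le_norm _ _
    rcases (norm_nonneg (E z)).eq_or_lt with h2 | h2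
    · rw [← h2]; exact norm_nonneg _
    · exact le_of_mul_le_mul_right h1 h2
  have : ProperSpace H := FiniteDimensional.proper ℂ H
  obtain ⟨f, hfE, hf1, hfs⟩ : ∃ f, E f = f ∧ ‖f‖ = 1 ∧ ‖P f‖ = ‖P * E‖ := by
    obtain ⟨v, hv, hvmax⟩ := (isCompact_closedBall (0 : H) 1).exists_isMaxOn
      ⟨0, by simp⟩ (f := fun z => ‖(P * E) z‖) (by fun_prop)
    have hv1 : ‖v‖ ≤ 1 := by simpa using hv
    have hle : ‖P * E‖ ≤ ‖P (E v)‖ := by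
      refine ContinuousLinearMap.opNorm_le_of_unit_norm (norm_nonneg _) fun z hz => ?_
      exact hvmax (by simp [hz])
    have hv2 := hmax (E v) (hEE v)
    have hEv := hcontr v
    -- The maximizer v over the ball need not lie in ran E; E v does, and it loses no norm because
    -- it still attains ‖P * E‖ > 0.
    have h1 : ‖E v‖ = 1 := by
      refine le_antisymm (hEv.trans hv1) ?_
      have := hle.trans hv2
      exact le_of_mul_le_mul_left (by linarith) h0
    exact ⟨E v, hEE v, h1, le_antisymm (by rw [h1, mul_one] at hv2; exact hv2) hle⟩
  exact h.sq_mul_le_of_maximizer hE hEE hTE hr hd (norm_nonneg _) hs2 hmax hfE hf1 hfs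

end

/-! ### Functional calculus of Hermitian matrices on eigenvectors. -/

section

variable {n : ℕ}

theorem inner_toEuclideanCLM_of_isHermitian {M : Matrix (Fin n) (Fin n) ℂ} (hM : M.IsHermitian)
    (x y : EuclideanSpace ℂ (Fin n)) :
    ⟪toEuclideanCLM (𝕜 := ℂ) M x, y⟫_ℂ = ⟪x, toEuclideanCLM (𝕜 := ℂ) M y⟫_ℂ :=
  isSymmetric_toEuclideanLin_iff.2 hM x y

theorem toEuclideanCLM_mul_apply (M N : Matrix (Fin n) (Fin n) ℂ)
    (x : EuclideanSpace ℂ (Fin n)) :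
    toEuclideanCLM (𝕜 := ℂ) (M * N) x =
      toEuclideanCLM (𝕜 := ℂ) M (toEuclideanCLM (𝕜 := ℂ) N x) := by
  rw [map_mul]; rfl

theorem toEuclideanCLM_eigenvectorBasis {M : Matrix (Fin n) (Fin n) ℂ} (hM : M.IsHermitian)
    (i : Fin n) : toEuclideanCLM (𝕜 := ℂ) M (hM.eigenvectorBasis i) =
      (hM.eigenvalues i : ℂ) • hM.eigenvectorBasis i := by
  have := hM.mulVec_eigenvectorBasis i
  ext j
  have h := congrFun this j
  simpa using h

theorem eq_of_forall_eigenvector {M X Y : Matrix (Fin n) (Fin n) ℂ} (hM : M.IsHermitian)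
    (h : ∀ (v : EuclideanSpace ℂ (Fin n)) (μ : ℝ), v ≠ 0 →
      toEuclideanCLM (𝕜 := ℂ) M v = (μ : ℂ) • v →
      toEuclideanCLM (𝕜 := ℂ) X v = toEuclideanCLM (𝕜 := ℂ) Y v) : X = Y := by
  apply (toEuclideanCLM (n := Fin n) (𝕜 := ℂ)).injective
  apply ContinuousLinearMap.coe_injective
  refine hM.eigenvectorBasis.toBasis.ext fun i => ?_
  rw [OrthonormalBasis.coe_toBasis]
  exact h _ _ (hM.eigenvectorBasis.orthonormal.ne_zero i) (toEuclideanCLM_eigenvectorBasis hM i)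

/-- The eigenvector is arbitrary, since the final statement concerns any orthonormal eigenvectors.
Expanded in `eigenvectorBasis`, it has nonzero coefficients only at eigenvalues equal to μ. -/
theorem cfc_apply_eigenvector {M : Matrix (Fin n) (Fin n) ℂ} (hM : M.IsHermitian) (f : ℝ → ℝ)
    {v : EuclideanSpace ℂ (Fin n)} {μ : ℝ}
    (hv : toEuclideanCLM (𝕜 := ℂ) M v = (μ : ℂ) • v) :
    toEuclideanCLM (𝕜 := ℂ) (cfc f M) v = (f μ : ℂ) • v := by
  have hbasis : ∀ i, toEuclideanCLM (𝕜 := ℂ) (cfc f M) (hM.eigenvectorBasis i) =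
      (f (hM.eigenvalues i) : ℂ) • hM.eigenvectorBasis i := by
    intro i
    apply (WithLp.ofLp_injective 2)
    have h1 := hM.star_eigenvectorUnitary_mulVec i
    have h2 := hM.eigenvectorUnitary_mulVec i
    rw [ofLp_toEuclideanCLM, hM.cfc_eq, IsHermitian.cfc, Unitary.conjStarAlgAut_apply,
      ← mulVec_mulVec, h1, ← mulVec_mulVec, diagonal_mulVec_single, mul_one]
    rw [show (Pi.single i ((RCLike.ofReal ∘ f ∘ hM.eigenvalues) i : ℂ) : Fin n → ℂ) =
      (f (hM.eigenvalues i) : ℂ) • Pi.single i 1 by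
        rw [← Pi.single_smul, smul_eq_mul, mul_one]; rfl, mulVec_smul, h2]
    rfl
  have hcoef : ∀ i, (f (hM.eigenvalues i) : ℂ) * ⟪hM.eigenvectorBasis i, v⟫_ℂ =
      (f μ : ℂ) * ⟪hM.eigenvectorBasis i, v⟫_ℂ := by
    intro i
    have h1 := inner_toEuclideanCLM_of_isHermitian hM (hM.eigenvectorBasis i) v
    rw [hv, toEuclideanCLM_eigenvectorBasis, inner_smul_left, inner_smul_right,
      Complex.conj_ofReal] at h1
    rcases mul_eq_mul_right_iff.1 h1 with h | h
    · rw [Complex.ofReal_inj.1 h]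
    · rw [h, mul_zero, mul_zero]
  conv_lhs => rw [← hM.eigenvectorBasis.sum_repr' v]
  conv_rhs => rw [← hM.eigenvectorBasis.sum_repr' v]
  rw [map_sum, Finset.smul_sum]
  refine Finset.sum_congr rfl fun i _ => ?_
  rw [map_smul, hbasis, smul_smul, smul_smul, mul_comm, hcoef]

theorem trace_cfc {M : Matrix (Fin n) (Fin n) ℂ} (hM : M.IsHermitian) (f : ℝ → ℝ) :
    (cfc f M).trace = ∑ i, (f (hM.eigenvalues i) : ℂ) := by
  rw [hM.cfc_eq, IsHermitian.cfc, Unitary.conjStarAlgAut_apply, trace_mul_comm, ← mul_assoc,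
    Unitary.coe_star_mul_self, one_mul, trace_diagonal]
  rfl

/-! ### The homotopy that switches on the off-diagonal blocks. -/

/-- The matrix path that scales the off-diagonal blocks of `M` with respect to `P` by `t`. -/
noncomputable def offDiagScale (M P : Matrix (Fin n) (Fin n) ℂ) (t : ℝ) :
    Matrix (Fin n) (Fin n) ℂ :=
  M - ((1 - t : ℝ) : ℂ) • (P * M + M * P - (2 : ℂ) • (P * M * P))

theorem toEuclideanCLM_offDiagScale (M P : Matrix (Fin n) (Fin n) ℂ) (t : ℝ) :
    toEuclideanCLM (𝕜 := ℂ) (offDiagScale M P t) =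
      toEuclideanCLM (𝕜 := ℂ) M - ((1 - t : ℝ) : ℂ) •
        (toEuclideanCLM (𝕜 := ℂ) P * toEuclideanCLM (𝕜 := ℂ) M +
          toEuclideanCLM (𝕜 := ℂ) M * toEuclideanCLM (𝕜 := ℂ) P -
          (2 : ℂ) • (toEuclideanCLM (𝕜 := ℂ) P * toEuclideanCLM (𝕜 := ℂ) M *
            toEuclideanCLM (𝕜 := ℂ) P)) := by
  simp only [offDiagScale, map_sub, map_smul, map_add, map_mul]

theorem offDiagScale_isHermitian {M P : Matrix (Fin n) (Fin n) ℂ} (hM : M.IsHermitian)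
    (hP : P.IsHermitian) (t : ℝ) : (offDiagScale M P t).IsHermitian := by
  simp only [IsHermitian, offDiagScale, conjTranspose_sub, conjTranspose_smul, conjTranspose_add,
    conjTranspose_mul, hM.eq, hP.eq, Complex.star_def, Complex.conj_ofReal, map_ofNat, mul_assoc]
  rw [add_comm (M * P)]

/-- A continuous function which is `1` on `[-p, p]` and `0` outside of `(-q, q)`. -/
noncomputable def plateau (p q x : ℝ) : ℝ := max 0 (min 1 ((q - |x|) / (q - p)))

theorem continuous_plateau (p q : ℝ) : Continuous (plateau p q) := by
  unfold plateau; fun_prop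

theorem plateau_eq_one {p q x : ℝ} (hpq : p < q) (hx : |x| ≤ p) : plateau p q x = 1 := by
  have : 1 ≤ (q - |x|) / (q - p) := by rw [le_div_iff₀ (by linarith)]; linarith
  rw [plateau, min_eq_left this, max_eq_right zero_le_one]

theorem plateau_eq_zero {p q x : ℝ} (hpq : p < q) (hx : q ≤ |x|) : plateau p q x = 0 := by
  have : (q - |x|) / (q - p) ≤ 0 := div_nonpos_of_nonpos_of_nonneg (by linarith) (by linarith)
  rw [plateau, min_eq_right (this.trans zero_le_one), max_eq_left this]

variable {M P : Matrix (Fin n) (Fin n) ℂ} {r d V δ : ℝ}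

/-- The ramp of the plateau lies in the spectral gap, so the functional calculus yields a genuine
projection. -/
theorem plateau_zero_or_one_of_eigenvalue {T Q : EuclideanSpace ℂ (Fin n) →L[ℂ]
      EuclideanSpace ℂ (Fin n)} (h : BlockBounds T Q r d V)
    (hr : 0 ≤ r) (hd : 0 < d) (hδ : 0 ≤ δ) (hδd : δ < d)
    (hVδ : V ^ 2 ≤ δ * (δ + d)) {v : EuclideanSpace ℂ (Fin n)} {μ : ℝ} (hv : v ≠ 0)
    (hTv : T v = (μ : ℂ) • v) :
    (|μ| ≤ r + δ ∧ plateau (r + δ) (r + d) μ = 1) ∨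
      (r + d ≤ |μ| ∧ plateau (r + δ) (r + d) μ = 0) := by
  rcases lt_or_ge |μ| (r + d) with h1 | h1
  · have := h.abs_eigenvalue_le hr hd hδ hVδ hv hTv h1
    exact Or.inl ⟨this, plateau_eq_one (by linarith) this⟩
  · exact Or.inr ⟨h1, plateau_eq_zero (by linarith) h1⟩

theorem norm_mul_cfc_plateau_sq_le (hM : M.IsHermitian)
    (h : BlockBounds (toEuclideanCLM (𝕜 := ℂ) M) (toEuclideanCLM (𝕜 := ℂ) P) r d V)
    (hr : 0 ≤ r) (hd : 0 < d) (hδ : 0 ≤ δ) (hδd : δ < d) (hVδ : V ^ 2 ≤ δ * (δ + d))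
    (hs2 : ‖P * cfc (plateau (r + δ) (r + d)) M‖ ^ 2 ≤ 2 / 3) :
    ‖P * cfc (plateau (r + δ) (r + d)) M‖ ^ 2 * (d ^ 2 + V ^ 2) ≤ V ^ 2 := by
  set E := cfc (plateau (r + δ) (r + d)) M with hE
  have hEh : E.IsHermitian := IsSelfAdjoint.cfc
  have hEE : E * E = E := eq_of_forall_eigenvector hM fun v μ hv hMv => by
    rw [toEuclideanCLM_mul_apply, hE, cfc_apply_eigenvector hM _ hMv, map_smul,
      cfc_apply_eigenvector hM _ hMv]
    rcases plateau_zero_or_one_of_eigenvalue h hr hd hδ hδd hVδ hv hMv with ⟨-, h1⟩ | ⟨-, h1⟩ <;>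
      simp [h1]
  have hME : M * E = E * M := eq_of_forall_eigenvector hM fun v μ hv hMv => by
    rw [toEuclideanCLM_mul_apply, toEuclideanCLM_mul_apply, hE, cfc_apply_eigenvector hM _ hMv,
      hMv, map_smul, map_smul, cfc_apply_eigenvector hM _ hMv, hMv, smul_comm]
  rw [← l2_opNorm_toEuclideanCLM, map_mul] at hs2 ⊢
  refine h.norm_sq_mul_le (inner_toEuclideanCLM_of_isHermitian hEh) (fun x => ?_) (fun x => ?_)
    hr hd hs2
  · rw [← toEuclideanCLM_mul_apply, hEE]
  · rw [← toEuclideanCLM_mul_apply, ← toEuclideanCLM_mul_apply, hME]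

/-- At t = 0 the matrix commutes with P, so both components of an eigenvector satisfy the eigenvalue
equation with the same μ; the two diagonal bounds force one of them to vanish. -/
theorem cfc_plateau_offDiagScale_zero (hM : M.IsHermitian) (hP : P.IsHermitian)
    (h : BlockBounds (toEuclideanCLM (𝕜 := ℂ) M) (toEuclideanCLM (𝕜 := ℂ) P) r d V)
    (hd : 0 < d) (hδ : 0 ≤ δ) (hδd : δ < d) :
    cfc (plateau (r + δ) (r + d)) (offDiagScale M P 0) = 1 - P := by
  have hM0 := offDiagScale_isHermitian hM hP 0
  refine eq_of_forall_eigenvector hM0 fun v μ hv hMv => ?_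
  have h0 := h.scale le_rfl zero_le_one
  rw [cfc_apply_eigenvector hM0 _ hMv, map_sub, map_one]
  rw [← toEuclideanCLM_offDiagScale] at h0
  set S := toEuclideanCLM (𝕜 := ℂ) (offDiagScale M P 0) with hS
  set Q := toEuclideanCLM (𝕜 := ℂ) P with hQ
  set T := toEuclideanCLM (𝕜 := ℂ) M with hT
  have hSz : ∀ z, S z = T z - (Q (T z) + T (Q z) - (2 : ℂ) • Q (T (Q z))) := fun z => by
    rw [hS, toEuclideanCLM_offDiagScale, sub_zero, Complex.ofReal_one, one_smul]; rfl
  have hcomm : Q (S v) = S (Q v) := by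
    simp only [hSz, map_sub, map_add, map_smul, h.proj_idem]
    module
  have hSQ : S (Q v) = (μ : ℂ) • Q v := by rw [← hcomm, hMv, map_smul]
  have hSy : S (v - Q v) = (μ : ℂ) • (v - Q v) := by rw [map_sub, hSQ, hMv, smul_sub]
  have n1 := h0.outer (Q v) (h.proj_idem v)
  have n2 := h0.inner (v - Q v) (by rw [map_sub, h.proj_idem, sub_self])
  rw [hSQ, map_smul, h.proj_idem, norm_smul, Complex.norm_real, Real.norm_eq_abs] at n1
  rw [hSy, map_smul, map_sub, h.proj_idem, sub_self, smul_zero, sub_zero, norm_smul,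
    Complex.norm_real, Real.norm_eq_abs] at n2
  rcases lt_or_ge |μ| (r + d) with h1 | h1
  · have hQv : Q v = 0 := by
      by_contra hne
      exact absurd (le_of_mul_le_mul_right n1 (norm_pos_iff.2 hne)) (not_le.2 h1)
    have hvne : 0 < ‖v‖ := norm_pos_iff.2 hv
    rw [hQv, sub_zero] at n2
    have := le_of_mul_le_mul_right n2 hvne
    rw [plateau_eq_one (by linarith) (by linarith), Complex.ofReal_one, one_smul]
    simp [hQv]
  · have hyv : v - Q v = 0 := by
      by_contra hne
      have := le_of_mul_le_mul_right n2 (norm_pos_iff.2 hne)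
      linarith
    rw [plateau_eq_zero (by linarith) h1, Complex.ofReal_zero, zero_smul]
    simpa using hyv.symm

/-- By compactness of [0,1] all spectra along the path lie in one ball. -/
theorem continuousOn_cfc_offDiagScale (hM : M.IsHermitian) (hP : P.IsHermitian) {f : ℝ → ℝ}
    (hf : Continuous f) :
    ContinuousOn (fun t => cfc f (offDiagScale M P t)) (Set.Icc 0 1) := by
  have hcont : Continuous (offDiagScale M P) := by unfold offDiagScale; fun_prop
  obtain ⟨K, hK⟩ := (isCompact_Icc (a := (0 : ℝ)) (b := 1)).exists_bound_of_continuousOn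
    hcont.continuousOn
  rcases subsingleton_or_nontrivial (Matrix (Fin n) (Fin n) ℂ) with h | h
  · have : (fun t => cfc f (offDiagScale M P t)) = fun _ => 0 := by
      ext1 t; exact Subsingleton.elim _ _
    rw [this]; exact continuousOn_const
  refine ContinuousOn.cfc' (isCompact_closedBall (0 : ℝ) K) f hcont.continuousOn
    (fun t ht x hx => ?_) (fun t _ => offDiagScale_isHermitian hM hP t) hf.continuousOn
  rw [mem_closedBall_zero_iff]
  exact (spectrum.norm_le_norm_of_mem hx).trans (hK t ht)

theorem offDiagScale_one : offDiagScale M P 1 = M := by simp [offDiagScale]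

/-- The homotopy argument: the spectral projection of `M` for `[-(r + δ), r + δ]` stays close to
`1 - P`. -/
theorem norm_mul_cfc_plateau_sq_mul_le (hM : M.IsHermitian) (hP : P.IsHermitian)
    (hPP : P * P = P)
    (h : BlockBounds (toEuclideanCLM (𝕜 := ℂ) M) (toEuclideanCLM (𝕜 := ℂ) P) r d V)
    (hr : 0 ≤ r) (hd : 0 < d) (hδ : 0 ≤ δ) (hδd : δ < d) (hVδ : V ^ 2 ≤ δ * (δ + d)) :
    ‖P * cfc (plateau (r + δ) (r + d)) M‖ ^ 2 * (d ^ 2 + V ^ 2) ≤ V ^ 2 := by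
  set s : ℝ → ℝ := fun t => ‖P * cfc (plateau (r + δ) (r + d)) (offDiagScale M P t)‖ ^ 2 with hs
  have hcont : ContinuousOn s (Set.Icc 0 1) := by
    have := continuousOn_cfc_offDiagScale hM hP (continuous_plateau (r + δ) (r + d))
    exact ((continuousOn_const.mul this).norm).pow 2
  have hbound : ∀ t ∈ Set.Icc (0 : ℝ) 1, s t ≤ 2 / 3 → s t * (d ^ 2 + V ^ 2) ≤ V ^ 2 := by
    intro t ht hst
    have h1 := h.scale ht.1 ht.2
    rw [← toEuclideanCLM_offDiagScale] at h1
    exact norm_mul_cfc_plateau_sq_le (offDiagScale_isHermitian hM hP t) h1 hr hd hδ hδd hVδ hst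
  have hs0 : s 0 = 0 := by
    simp only [hs]
    rw [cfc_plateau_offDiagScale_zero hM hP h hd hδ hδd, mul_sub, mul_one, hPP, sub_self,
      norm_zero, zero_pow two_ne_zero]
  -- This puts V²/(d²+V²) strictly below 2/3, so a parameter with s t = 2/3 would contradict
  -- `hbound`.
  have hV2 : V ^ 2 < 2 * d ^ 2 := by nlinarith
  have hs1 : s 1 ≤ 2 / 3 := by
    by_contra! hcon
    obtain ⟨t, ht, hst⟩ := intermediate_value_Icc zero_le_one hcont
      (show (2 / 3 : ℝ) ∈ Set.Icc (s 0) (s 1) from ⟨by rw [hs0]; norm_num, hcon.le⟩)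
    have := hbound t ht hst.le
    rw [hst] at this
    linarith
  have := hbound 1 ⟨zero_le_one, le_rfl⟩ hs1
  simpa only [hs, offDiagScale_one] using this

/-- Along the path the trace counts inner eigenvalues, so it is continuous and integer-valued, hence
equal to its value at t = 0. -/
theorem trace_cfc_plateau (hM : M.IsHermitian) (hP : P.IsHermitian)
    (h : BlockBounds (toEuclideanCLM (𝕜 := ℂ) M) (toEuclideanCLM (𝕜 := ℂ) P) r d V)
    (hr : 0 ≤ r) (hd : 0 < d) (hδ : 0 ≤ δ) (hδd : δ < d) (hVδ : V ^ 2 ≤ δ * (δ + d)) :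
    (cfc (plateau (r + δ) (r + d)) M).trace = (1 - P).trace := by
  set F : ℝ → Matrix (Fin n) (Fin n) ℂ :=
    fun t => cfc (plateau (r + δ) (r + d)) (offDiagScale M P t) with hF
  have hcont : ContinuousOn (fun t => (F t).trace) (Set.Icc 0 1) := by
    have h1 := continuousOn_cfc_offDiagScale hM hP (continuous_plateau (r + δ) (r + d))
    exact (continuous_id.matrix_trace).comp_continuousOn h1
  have hnat : ∀ t ∈ Set.Icc (0 : ℝ) 1, ∃ m : ℤ, (F t).trace = m := by
    intro t ht
    have h1 := h.scale ht.1 ht.2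
    rw [← toEuclideanCLM_offDiagScale] at h1
    have ht' := offDiagScale_isHermitian hM hP t
    have h2 : ∀ i, ∃ m : ℤ, (plateau (r + δ) (r + d) (ht'.eigenvalues i) : ℂ) = m := fun i => by
      rcases plateau_zero_or_one_of_eigenvalue h1 hr hd hδ hδd hVδ
        (ht'.eigenvectorBasis.orthonormal.ne_zero i) (toEuclideanCLM_eigenvectorBasis ht' i)
        with ⟨-, h3⟩ | ⟨-, h3⟩
      · exact ⟨1, by simp [h3]⟩
      · exact ⟨0, by simp [h3]⟩
    choose m hm using h2
    exact ⟨∑ i, m i, by simp only [hF, trace_cfc ht', hm]; push_cast; rfl⟩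
  have hdisc : IsDiscrete (Set.range ((↑) : ℤ → ℂ)) := by
    have : ((↑) : ℤ → ℂ) = Complex.ofReal ∘ ((↑) : ℤ → ℝ) := by ext1; simp
    rw [this]
    exact (Complex.isometry_ofReal.isEmbedding.comp
      Int.isClosedEmbedding_coe_real.isEmbedding).isInducing.isDiscrete_range
  have hmaps : Set.MapsTo (fun t => (F t).trace) (Set.Icc 0 1) (Set.range ((↑) : ℤ → ℂ)) :=
    fun t ht => (hnat t ht).imp fun _ hm => hm.symm
  have key := isPreconnected_Icc.constant_of_mapsTo hdisc hcont hmaps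
    (show (1 : ℝ) ∈ Set.Icc 0 1 from ⟨zero_le_one, le_rfl⟩)
    (show (0 : ℝ) ∈ Set.Icc 0 1 from ⟨le_rfl, zero_le_one⟩)
  simpa only [hF, cfc_plateau_offDiagScale_zero hM hP h hd hδ hδd, offDiagScale_one] using key

end

/-! ### Rectangular matrices, principal angles, and block bounds from spectra. -/

section

variable {n m k l : ℕ}

theorem toEuclideanLin_mul_apply (M : Matrix (Fin n) (Fin m) ℂ) (N : Matrix (Fin m) (Fin k) ℂ)
    (x : EuclideanSpace ℂ (Fin k)) :
    toEuclideanLin (M * N) x = toEuclideanLin M (toEuclideanLin N x) := by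
  apply WithLp.ofLp_injective 2
  simp

theorem toEuclideanLin_one_apply (x : EuclideanSpace ℂ (Fin n)) :
    toEuclideanLin (1 : Matrix (Fin n) (Fin n) ℂ) x = x := by
  apply WithLp.ofLp_injective 2
  simp

theorem norm_toEuclideanLin_le (M : Matrix (Fin n) (Fin m) ℂ) (x : EuclideanSpace ℂ (Fin m)) :
    ‖toEuclideanLin M x‖ ≤ ‖M‖ * ‖x‖ :=
  M.l2_opNorm_mulVec x

theorem inner_toEuclideanLin (M : Matrix (Fin n) (Fin m) ℂ) (x : EuclideanSpace ℂ (Fin m))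
    (y : EuclideanSpace ℂ (Fin n)) :
    ⟪toEuclideanLin M x, y⟫_ℂ = ⟪x, toEuclideanLin Mᴴ y⟫_ℂ := by
  rw [toEuclideanLin_conjTranspose_eq_adjoint, LinearMap.adjoint_inner_right]

theorem norm_toEuclideanLin_of_conjTranspose_mul_self {Q : Matrix (Fin n) (Fin m) ℂ}
    (hQ : Qᴴ * Q = 1) (x : EuclideanSpace ℂ (Fin m)) : ‖toEuclideanLin Q x‖ = ‖x‖ := by
  have : ⟪toEuclideanLin Q x, toEuclideanLin Q x⟫_ℂ = ⟪x, x⟫_ℂ := by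
    rw [inner_toEuclideanLin, ← toEuclideanLin_mul_apply, hQ, toEuclideanLin_one_apply]
  rw [@norm_eq_sqrt_re_inner ℂ, this, ← @norm_eq_sqrt_re_inner ℂ]

theorem columnSpan_eq_range (Q : Matrix (Fin n) (Fin m) ℂ) :
    columnSpan Q = LinearMap.range (toEuclideanLin Q) := by
  rw [LinearMap.range_eq_map, ← (EuclideanSpace.basisFun (Fin m) ℂ).toBasis.span_eq,
    Submodule.map_span, columnSpan, ← Set.range_comp]
  congr 2
  ext1 j
  apply WithLp.ofLp_injective 2
  simp

theorem finrank_columnSpan {Q : Matrix (Fin n) (Fin m) ℂ} (hQ : Qᴴ * Q = 1) :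
    finrank ℂ (columnSpan Q) = m := by
  rw [columnSpan_eq_range, LinearMap.finrank_range_of_inj, finrank_euclideanSpace_fin]
  refine (injective_iff_map_eq_zero _).2 fun x hx => ?_
  rw [← norm_eq_zero, ← norm_toEuclideanLin_of_conjTranspose_mul_self hQ, hx, norm_zero]

theorem exists_norm_apply_eq_singularValues_mul {E F : Type*} [NormedAddCommGroup E]
    [InnerProductSpace ℂ E] [FiniteDimensional ℂ E] [NormedAddCommGroup F] [InnerProductSpace ℂ F]
    [FiniteDimensional ℂ F] (T : E →ₗ[ℂ] F) {i : ℕ} (hi : i < finrank ℂ E) :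
    ∃ x, x ≠ 0 ∧ ‖T x‖ = T.singularValues i * ‖x‖ := by
  obtain ⟨x, hx⟩ := (T.hasEigenvalue_adjoint_comp_self_sq_singularValues hi).exists_hasEigenvector
  refine ⟨x, hx.2, ?_⟩
  have hx1 := hx.apply_eq_smul
  rw [LinearMap.comp_apply] at hx1
  have hsq : ‖T x‖ ^ 2 = T.singularValues i ^ 2 * ‖x‖ ^ 2 := by
    rw [← @inner_self_eq_norm_sq ℂ, ← LinearMap.adjoint_inner_right, hx1, inner_smul_right,
      ← @inner_self_eq_norm_sq ℂ]
    have := RCLike.re_ofReal_mul (K := ℂ) (T.singularValues i ^ 2) ⟪x, x⟫_ℂ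
    rw [← this]
    norm_cast
  rw [← mul_pow] at hsq
  have hnn := T.singularValues_nonneg i
  exact (pow_left_inj₀ (norm_nonneg _) (by positivity) two_ne_zero).1 hsq

/-- The cosine of the largest angle is the singular value of index k - 1, attained at a nonzero
vector of F, where the hypothesis is applied. -/
theorem largestPrincipalAngle_le_arccos {F G : Submodule ℂ (EuclideanSpace ℂ (Fin n))}
    (hk : 0 < k) (hF : finrank ℂ F = k) (hG : finrank ℂ G = k) {c : ℝ}
    (h : ∀ x ∈ F, c * ‖x‖ ≤ ‖G.orthogonalProjectionOnto x‖) :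
    largestPrincipalAngle F G ≤ Real.arccos c := by
  rw [largestPrincipalAngle, principalAngle, hF, hG, min_self]
  apply Real.antitone_arccos
  obtain ⟨x, hx0, hx⟩ := exists_norm_apply_eq_singularValues_mul (E := F) (F := G)
    (G.orthogonalProjectionOnto.toLinearMap ∘ₗ F.subtype) (i := k - 1) (by rw [hF]; omega)
  exact le_of_mul_le_mul_right ((h x x.2).trans hx.le)
    (norm_pos_iff.2 (Subtype.coe_ne_coe.2 hx0))

theorem norm_sq_sub_smul_eq_sum {N : Matrix (Fin m) (Fin m) ℂ} (hN : N.IsHermitian) (c : ℝ)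
    (w : EuclideanSpace ℂ (Fin m)) :
    ‖toEuclideanLin N w - (c : ℂ) • w‖ ^ 2 =
      ∑ i, (hN.eigenvalues i - c) ^ 2 * ‖⟪hN.eigenvectorBasis i, w⟫_ℂ‖ ^ 2 := by
  rw [← hN.eigenvectorBasis.sum_sq_norm_inner_right]
  refine Finset.sum_congr rfl fun i _ => ?_
  have h1 : ⟪hN.eigenvectorBasis i, toEuclideanLin N w⟫_ℂ =
      (hN.eigenvalues i : ℂ) * ⟪hN.eigenvectorBasis i, w⟫_ℂ := by
    have := inner_toEuclideanCLM_of_isHermitian hN (hN.eigenvectorBasis i) w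
    rw [toEuclideanCLM_eigenvectorBasis, inner_smul_left, Complex.conj_ofReal] at this
    exact this.symm
  rw [inner_sub_right, inner_smul_right, h1, ← sub_mul, norm_mul, mul_pow, ← Complex.ofReal_sub,
    Complex.norm_real, Real.norm_eq_abs, sq_abs]

theorem eigenvalues_mem_of_spectrum_subset {N : Matrix (Fin m) (Fin m) ℂ} (hN : N.IsHermitian)
    {S : Set ℝ} (h : spectrum ℂ N ⊆ Complex.ofReal '' S) (i : Fin m) : hN.eigenvalues i ∈ S := by
  obtain ⟨x, hx, hxi⟩ := h (spectrum.algebraMap_mem ℂ (hN.eigenvalues_mem_spectrum_real i))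
  rwa [Complex.ofReal_injective hxi] at hx

theorem mul_norm_le_norm_sub_smul {N : Matrix (Fin m) (Fin m) ℂ} (hN : N.IsHermitian) {c ρ : ℝ}
    (hρ : 0 ≤ ρ) (h : ∀ i, ρ ≤ |hN.eigenvalues i - c|) (w : EuclideanSpace ℂ (Fin m)) :
    ρ * ‖w‖ ≤ ‖toEuclideanLin N w - (c : ℂ) • w‖ := by
  rw [← pow_le_pow_iff_left₀ (by positivity) (norm_nonneg _) two_ne_zero,
    norm_sq_sub_smul_eq_sum hN, mul_pow, ← hN.eigenvectorBasis.sum_sq_norm_inner_right,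
    Finset.mul_sum]
  refine Finset.sum_le_sum fun i _ => mul_le_mul_of_nonneg_right ?_ (sq_nonneg _)
  rw [← sq_abs (_ - c)]
  exact pow_le_pow_left₀ hρ (h i) 2

theorem norm_sub_smul_le_mul_norm {N : Matrix (Fin m) (Fin m) ℂ} (hN : N.IsHermitian) {c ρ : ℝ}
    (hρ : 0 ≤ ρ) (h : ∀ i, |hN.eigenvalues i - c| ≤ ρ) (w : EuclideanSpace ℂ (Fin m)) :
    ‖toEuclideanLin N w - (c : ℂ) • w‖ ≤ ρ * ‖w‖ := by
  rw [← pow_le_pow_iff_left₀ (norm_nonneg _) (by positivity) two_ne_zero,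
    norm_sq_sub_smul_eq_sum hN, mul_pow, ← hN.eigenvectorBasis.sum_sq_norm_inner_right,
    Finset.mul_sum]
  refine Finset.sum_le_sum fun i _ => mul_le_mul_of_nonneg_right ?_ (sq_nonneg _)
  rw [← sq_abs (_ - c)]
  exact pow_le_pow_left₀ (abs_nonneg _) (h i) 2

/-- The double-angle formula for t = tan θ reads td = V(1 - t²); multiplied by V this is the
quadratic equation for δ = Vt. -/
theorem tan_half_arctan_relations {V d δ : ℝ} (hV : 0 ≤ V) (hd : 0 < d)
    (hδ : δ = V * Real.tan (1 / 2 * Real.arctan (2 * V / d))) :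
    0 ≤ δ ∧ V ^ 2 = δ * (δ + d) := by
  set θ := 1 / 2 * Real.arctan (2 * V / d) with hθ
  have h2 : Real.tan (2 * θ) = 2 * V / d := by
    rw [hθ, ← mul_assoc]; norm_num [Real.tan_arctan]
  have hθ0 : 0 ≤ θ := mul_nonneg (by norm_num) (Real.arctan_nonneg.2 (by positivity))
  have hθ1 : θ ≤ Real.pi / 2 := by
    have := Real.arctan_lt_pi_div_two (2 * V / d)
    have := Real.pi_pos
    linarith
  have ht := Real.tan_nonneg_of_nonneg_of_le_pi_div_two hθ0 hθ1
  refine ⟨hδ ▸ mul_nonneg hV ht, ?_⟩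
  rw [Real.tan_two_mul] at h2
  rcases eq_or_ne (1 - Real.tan θ ^ 2) 0 with h0 | h0
  -- With a vanishing denominator the double-angle quotient takes the default value 0, which leaves
  -- only V = 0.
  · rw [h0, div_zero, eq_comm, div_eq_zero_iff] at h2
    have hV0 : V = 0 := by rcases h2 with h | h <;> linarith
    simp [hδ, hV0]
  · rw [div_eq_div_iff h0 hd.ne'] at h2
    rw [hδ]
    linear_combination -V / 2 * h2

/-- The two diagonal blocks of a Hermitian matrix and its residual provide block bounds for the
matrix centered at the midpoint of `[a, b]`. -/
theorem blockBounds_of_spectrum {A : Matrix (Fin n) (Fin n) ℂ} (hA : A.IsHermitian)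
    {Q₁ : Matrix (Fin n) (Fin k) ℂ} {Q₂ : Matrix (Fin n) (Fin l) ℂ}
    (h₁₁ : Q₁ᴴ * Q₁ = 1) (h₂₂ : Q₂ᴴ * Q₂ = 1) (hsum : Q₁ * Q₁ᴴ + Q₂ * Q₂ᴴ = 1)
    {a b d : ℝ} (hab : a ≤ b) (hd : 0 < d)
    (hspec₁ : spectrum ℂ (Q₁ᴴ * A * Q₁) ⊆ Complex.ofReal '' (Set.Iic (a - d) ∪ Set.Ici (b + d)))
    (hspec₂ : spectrum ℂ (Q₂ᴴ * A * Q₂) ⊆ Complex.ofReal '' Set.Icc a b) :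
    BlockBounds (toEuclideanCLM (𝕜 := ℂ) (A - (((a + b) / 2 : ℝ) : ℂ) • 1))
      (toEuclideanCLM (𝕜 := ℂ) (Q₁ * Q₁ᴴ)) ((b - a) / 2) d ‖A * Q₁ - Q₁ * (Q₁ᴴ * A * Q₁)‖ := by
  set c : ℝ := (a + b) / 2 with hc
  set R := A * Q₁ - Q₁ * (Q₁ᴴ * A * Q₁) with hR
  have hP : (Q₁ * Q₁ᴴ).IsHermitian := isHermitian_mul_conjTranspose_self Q₁
  have hM : (A - (c : ℂ) • 1).IsHermitian := by
    refine hA.sub ?_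
    simp [IsHermitian, conjTranspose_smul]
  have hA₁ : (Q₁ᴴ * A * Q₁).IsHermitian := isHermitian_conjTranspose_mul_mul _ hA
  have hA₂ : (Q₂ᴴ * A * Q₂).IsHermitian := isHermitian_conjTranspose_mul_mul _ hA
  have eM : ∀ x, toEuclideanCLM (𝕜 := ℂ) (A - (c : ℂ) • 1) x =
      toEuclideanLin A x - (c : ℂ) • x := fun x => by
    rw [map_sub, map_smul, map_one]; rfl
  have eP : ∀ x, toEuclideanCLM (𝕜 := ℂ) (Q₁ * Q₁ᴴ) x =
      toEuclideanLin Q₁ (toEuclideanLin Q₁ᴴ x) := fun x => toEuclideanLin_mul_apply _ _ x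
  have eS : ∀ x, x - toEuclideanLin Q₁ (toEuclideanLin Q₁ᴴ x) =
      toEuclideanLin Q₂ (toEuclideanLin Q₂ᴴ x) := fun x => by
    rw [← toEuclideanLin_mul_apply, ← toEuclideanLin_mul_apply, sub_eq_iff_eq_add',
      ← LinearMap.add_apply, ← map_add, hsum, toEuclideanLin_one_apply]
  have e₁₁ : ∀ w, toEuclideanLin Q₁ᴴ (toEuclideanLin Q₁ w) = w := fun w => by
    rw [← toEuclideanLin_mul_apply, h₁₁, toEuclideanLin_one_apply]
  have e₂₂ : ∀ w, toEuclideanLin Q₂ᴴ (toEuclideanLin Q₂ w) = w := fun w => by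
    rw [← toEuclideanLin_mul_apply, h₂₂, toEuclideanLin_one_apply]
  have hPP : ∀ x, toEuclideanCLM (𝕜 := ℂ) (Q₁ * Q₁ᴴ) (toEuclideanCLM (𝕜 := ℂ) (Q₁ * Q₁ᴴ) x) =
      toEuclideanCLM (𝕜 := ℂ) (Q₁ * Q₁ᴴ) x := fun x => by rw [eP, eP, e₁₁]
  have eR : ∀ w, toEuclideanLin A (toEuclideanLin Q₁ w) -
      toEuclideanLin Q₁ (toEuclideanLin Q₁ᴴ (toEuclideanLin A (toEuclideanLin Q₁ w))) =
      toEuclideanLin R w := fun w => by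
    rw [hR, map_sub, LinearMap.sub_apply]
    simp only [toEuclideanLin_mul_apply]
  refine ⟨inner_toEuclideanCLM_of_isHermitian hM, inner_toEuclideanCLM_of_isHermitian hP,
    hPP, fun x hx => ?_, fun y hy => ?_, fun x hx => ?_, fun y hy => ?_⟩
  · rw [eP] at hx
    obtain ⟨w, rfl⟩ : ∃ w, x = toEuclideanLin Q₁ w := ⟨_, hx.symm⟩
    have := mul_norm_le_norm_sub_smul hA₁ (c := c) (ρ := (b - a) / 2 + d) (by linarith)
      (fun i => ?_) w
    · rw [eM, eP, norm_toEuclideanLin_of_conjTranspose_mul_self h₁₁,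
        norm_toEuclideanLin_of_conjTranspose_mul_self h₁₁, map_sub, map_smul, e₁₁]
      simpa only [toEuclideanLin_mul_apply] using this
    · rw [le_abs]
      rcases eigenvalues_mem_of_spectrum_subset hA₁ hspec₁ i with h | h
      · right; have := Set.mem_Iic.1 h; linarith
      · left; have := Set.mem_Ici.1 h; linarith
  · rw [eP] at hy
    have hy' := eS y
    rw [hy, sub_zero] at hy'
    obtain ⟨w, rfl⟩ : ∃ w, y = toEuclideanLin Q₂ w := ⟨_, hy'⟩
    have := norm_sub_smul_le_mul_norm hA₂ (c := c) (ρ := (b - a) / 2) (by linarith)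
      (fun i => ?_) w
    · rw [eM, eP, eS, norm_toEuclideanLin_of_conjTranspose_mul_self h₂₂,
        norm_toEuclideanLin_of_conjTranspose_mul_self h₂₂, map_sub, map_smul, e₂₂]
      simpa only [toEuclideanLin_mul_apply] using this
    · rw [abs_le]
      obtain ⟨h1, h2⟩ := eigenvalues_mem_of_spectrum_subset hA₂ hspec₂ i
      constructor <;> linarith
  · rw [eP] at hx
    obtain ⟨w, rfl⟩ : ∃ w, x = toEuclideanLin Q₁ w := ⟨_, hx.symm⟩
    rw [eM, eP, map_sub, map_sub, map_smul, map_smul, e₁₁, sub_sub_sub_cancel_right, eR,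
      norm_toEuclideanLin_of_conjTranspose_mul_self h₁₁]
    exact norm_toEuclideanLin_le R w
  -- On ker P the second term of Rᴴ vanishes, so Q₁ᴴA acts there as Rᴴ, whose norm is ‖R‖.
  · have hRH : Rᴴ = Q₁ᴴ * A - (Q₁ᴴ * A * Q₁) * Q₁ᴴ := by
      rw [hR, conjTranspose_sub, conjTranspose_mul, conjTranspose_mul, hA.eq, hA₁.eq]
    have hQy : toEuclideanLin Q₁ᴴ y = 0 := by
      rw [eP] at hy
      rw [← e₁₁ (toEuclideanLin Q₁ᴴ y), hy, map_zero]
    have : toEuclideanLin Q₁ᴴ (toEuclideanLin A y) = toEuclideanLin Rᴴ y := by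
      rw [hRH, map_sub, LinearMap.sub_apply]
      simp only [toEuclideanLin_mul_apply, hQy, map_zero, sub_zero]
    rw [eM, map_sub, map_smul, hy, smul_zero, sub_zero, eP,
      norm_toEuclideanLin_of_conjTranspose_mul_self h₁₁, this, ← l2_opNorm_conjTranspose R]
    exact norm_toEuclideanLin_le _ y

end

/-! ### From the projection norm to the angle; numbering the eigenvectors. -/

section

variable {n k : ℕ}

/-- If the columns of `X` span the range of the projection `1 - E` and `‖P E‖` is bounded by the
sine of `arctan (V / d)`, then the columns of `Q` and `X` make an angle of at most
`arctan (V / d)`. -/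
theorem largestPrincipalAngle_le_arctan {E : Matrix (Fin n) (Fin n) ℂ} (hE : E.IsHermitian)
    {Q X : Matrix (Fin n) (Fin k) ℂ} (hk : 0 < k) (hQ : Qᴴ * Q = 1) (hX : Xᴴ * X = 1)
    (hEX : 1 - E = X * Xᴴ) {V d : ℝ} (hV : 0 ≤ V) (hd : 0 < d)
    (h : ‖Q * Qᴴ * E‖ ^ 2 * (d ^ 2 + V ^ 2) ≤ V ^ 2) :
    largestPrincipalAngle (columnSpan Q) (columnSpan X) ≤ Real.arctan (V / d) := by
  rw [Real.arctan_eq_arccos (by positivity)]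
  refine largestPrincipalAngle_le_arccos hk (finrank_columnSpan hQ) (finrank_columnSpan hX)
    fun x hx => ?_
  rw [columnSpan_eq_range] at hx
  obtain ⟨w, rfl⟩ := hx
  set x := toEuclideanLin Q w with hxw
  set G := columnSpan X with hG
  set s := ‖Q * Qᴴ * E‖ with hs
  have hPx : toEuclideanLin (Q * Qᴴ) x = x := by
    rw [hxw, ← toEuclideanLin_mul_apply, Matrix.mul_assoc, hQ, Matrix.mul_one]
  have hEx : ‖toEuclideanLin E x‖ ≤ s * ‖x‖ := by
    have h1 := norm_toEuclideanLin_le (E * (Q * Qᴴ)) x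
    have h2 : ‖E * (Q * Qᴴ)‖ = s := by
      rw [hs, ← l2_opNorm_conjTranspose (Q * Qᴴ * E), conjTranspose_mul, hE.eq,
        (isHermitian_mul_conjTranspose_self Q).eq]
    rwa [toEuclideanLin_mul_apply, hPx, h2] at h1
  -- This point of G is within ‖E x‖ ≤ s‖x‖ of x, which bounds the distance to G; Pythagoras then
  -- bounds the projection below.
  have hmem : x - toEuclideanLin E x ∈ G := by
    rw [hG, columnSpan_eq_range]
    refine ⟨toEuclideanLin Xᴴ x, ?_⟩
    rw [← toEuclideanLin_mul_apply, ← hEX, map_sub, LinearMap.sub_apply, toEuclideanLin_one_apply]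
  have hdist : ‖x - G.starProjection x‖ ≤ s * ‖x‖ := by
    rw [Submodule.starProjection_minimal]
    refine (ciInf_le ⟨0, ?_⟩ ⟨_, hmem⟩).trans ?_
    · rintro _ ⟨y, rfl⟩; exact norm_nonneg _
    · simpa using hEx
  have hpyth : ‖x‖ ^ 2 = ‖G.orthogonalProjectionOnto x‖ ^ 2 + ‖x - G.starProjection x‖ ^ 2 := by
    rw [G.norm_sq_eq_add_norm_sq_projection x, ← Submodule.starProjection_orthogonal_val]
    rfl
  have hs1 : s ^ 2 ≤ V ^ 2 / (d ^ 2 + V ^ 2) := by rwa [le_div_iff₀ (by positivity)]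
  have hs2 : ((√(1 + (V / d) ^ 2))⁻¹) ^ 2 = 1 - V ^ 2 / (d ^ 2 + V ^ 2) := by
    rw [inv_pow, Real.sq_sqrt (by positivity)]
    field_simp
    ring
  rw [← pow_le_pow_iff_left₀ (by positivity) (norm_nonneg _) two_ne_zero, mul_pow, hs2]
  have h3 : ‖x - G.starProjection x‖ ^ 2 ≤ (s * ‖x‖) ^ 2 := by gcongr
  have h4 : s ^ 2 * ‖x‖ ^ 2 ≤ V ^ 2 / (d ^ 2 + V ^ 2) * ‖x‖ ^ 2 := by gcongr
  rw [mul_pow] at h3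
  linarith

theorem exists_sumEquiv_of_card {p : Fin n → Prop} [DecidablePred p] (hkn : k ≤ n)
    (hp : Fintype.card {i // p i} = n - k) :
    ∃ e : Fin k ⊕ Fin (n - k) ≃ Fin n, (∀ i, ¬ p (e (Sum.inl i))) ∧ ∀ j, p (e (Sum.inr j)) := by
  have hp' : Fintype.card {i // ¬ p i} = k := by
    rw [Fintype.card_subtype_compl, hp, Fintype.card_fin]; omega
  let e₁ : Fin k ≃ {i // ¬ p i} := (Fintype.equivFinOfCardEq hp').symm
  let e₂ : Fin (n - k) ≃ {i // p i} := (Fintype.equivFinOfCardEq hp).symm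
  refine ⟨(Equiv.sumComm _ _).trans ((Equiv.sumCongr e₂ e₁).trans (Equiv.sumCompl p)),
    fun i => ?_, fun j => ?_⟩
  · simpa using (e₁ i).2
  · simpa using (e₂ j).2

/-- A Hermitian matrix in diagonal form has real diagonal entries. -/
theorem exists_real_diagonal_of_isDiag {A Y : Matrix (Fin n) (Fin n) ℂ} (hA : A.IsHermitian)
    (hD : (Yᴴ * A * Y).IsDiag) :
    ∃ μ : Fin n → ℝ, Yᴴ * A * Y = diagonal fun i => (μ i : ℂ) := by
  have hH : (Yᴴ * A * Y).IsHermitian := isHermitian_conjTranspose_mul_mul _ hA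
  refine ⟨fun i => ((Yᴴ * A * Y) i i).re, ?_⟩
  rw [← hD.diagonal_diag]
  congr 1
  ext1 i
  simpa using (hH.coe_re_apply_self i).symm

end

/-! ### Assembly of the main theorem. -/

theorem proposition3 (n k : ℕ) (hk : 1 < k) (hkn : k < n)
    (A : Matrix (Fin n) (Fin n) ℂ) (hA : A.IsHermitian)
    (Q₁ : Matrix (Fin n) (Fin k) ℂ) (Q₂ : Matrix (Fin n) (Fin (n - k)) ℂ)
    (hQ : (fromCols Q₁ Q₂)ᴴ * fromCols Q₁ Q₂ = 1) (hQ' : fromCols Q₁ Q₂ * (fromCols Q₁ Q₂)ᴴ = 1)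
    (a b d : ℝ) (hab : a ≤ b) (hd : 0 < d)
    (A₁ : Matrix (Fin k) (Fin k) ℂ) (hA₁ : A₁ = Q₁ᴴ * A * Q₁)
    (A₂ : Matrix (Fin (n - k)) (Fin (n - k)) ℂ) (hA₂ : A₂ = Q₂ᴴ * A * Q₂)
    (hspec₁ : spectrum ℂ A₁ ⊆ Complex.ofReal '' (Set.Iic (a - d) ∪ Set.Ici (b + d)))
    (hspec₂ : spectrum ℂ A₂ ⊆ Complex.ofReal '' Set.Icc a b)
    (R : Matrix (Fin n) (Fin k) ℂ) (hR : R = A * Q₁ - Q₁ * A₁)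
    (hRd : ‖R‖ < √2 * d)
    (δR : ℝ) (hδR : δR = ‖R‖ * Real.tan (1 / 2 * Real.arctan (2 * ‖R‖ / d))) :
    δR < d ∧
    -- orthonormal eigenvectors of `A` exist (they are the columns of `Y`)
    (∃ Y ∈ unitaryGroup (Fin n) ℂ, (Yᴴ * A * Y).IsDiag) ∧
    -- and any `n` orthonormal eigenvectors of `A` can be renumbered as claimed
    ∀ Y ∈ unitaryGroup (Fin n) ℂ, (Yᴴ * A * Y).IsDiag →
      ∃ (e : Fin k ⊕ Fin (n - k) ≃ Fin n)
        (X₁ : Matrix (Fin n) (Fin k) ℂ) (X₂ : Matrix (Fin n) (Fin (n - k)) ℂ)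
        (Λ₁ : Matrix (Fin k) (Fin k) ℂ) (Λ₂ : Matrix (Fin (n - k)) (Fin (n - k)) ℂ),
        fromCols X₁ X₂ = Y.submatrix id e ∧
        (fromCols X₁ X₂)ᴴ * fromCols X₁ X₂ = 1 ∧
        fromCols X₁ X₂ * (fromCols X₁ X₂)ᴴ = 1 ∧
        (fromCols X₁ X₂)ᴴ * A * fromCols X₁ X₂ = fromBlocks Λ₁ 0 0 Λ₂ ∧
        Λ₁.IsDiag ∧ Λ₂.IsDiag ∧
        spectrum ℂ Λ₁ ⊆ Complex.ofReal '' (Set.Iic (a - d) ∪ Set.Ici (b + d)) ∧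
        spectrum ℂ Λ₂ ⊆ Complex.ofReal '' Set.Icc (a - δR) (b + δR) ∧
        largestPrincipalAngle (columnSpan Q₁) (columnSpan X₁) < Real.pi / 2 ∧
        Real.tan (largestPrincipalAngle (columnSpan Q₁) (columnSpan X₁)) ≤ ‖R‖ / d := by
  subst hA₁ hA₂
  rw [conjTranspose_fromCols_eq_fromRows_conjTranspose, fromRows_mul_fromCols,
    ← fromBlocks_one, fromBlocks_inj] at hQ
  obtain ⟨h₁₁, -, -, h₂₂⟩ := hQ
  rw [conjTranspose_fromCols_eq_fromRows_conjTranspose, fromCols_mul_fromRows] at hQ'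
  have hbb := blockBounds_of_spectrum hA h₁₁ h₂₂ hQ' hab hd hspec₁ hspec₂
  rw [← hR] at hbb
  obtain ⟨hδ0, hVδ⟩ := tan_half_arctan_relations (norm_nonneg R) hd hδR
  have hV2 : ‖R‖ ^ 2 < 2 * d ^ 2 := by
    have : ‖R‖ ^ 2 < (√2 * d) ^ 2 := by gcongr
    rwa [mul_pow, Real.sq_sqrt (by norm_num)] at this
  have hδd : δR < d := by
    by_contra! hcon
    have : d * (d + d) ≤ δR * (δR + d) := by gcongr
    linarith
  refine ⟨hδd, ⟨hA.eigenvectorUnitary, hA.eigenvectorUnitary.2, ?_⟩, fun Y hY hD => ?_⟩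
  · have h1 : (hA.eigenvectorUnitary : Matrix (Fin n) (Fin n) ℂ)ᴴ * A *
        (hA.eigenvectorUnitary : Matrix (Fin n) (Fin n) ℂ) =
        diagonal (RCLike.ofReal ∘ hA.eigenvalues) := by
      have := hA.conjStarAlgAut_star_eigenvectorUnitary
      rw [Unitary.conjStarAlgAut_apply] at this
      simpa [star_eq_conjTranspose] using this
    rw [h1]
    exact isDiag_diagonal _
  obtain ⟨μ, hμ⟩ := exists_real_diagonal_of_isDiag hA hD
  have hYY : Yᴴ * Y = 1 := mem_unitaryGroup_iff'.1 hY
  have hYY' : Y * Yᴴ = 1 := mem_unitaryGroup_iff.1 hY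
  set c : ℝ := (a + b) / 2 with hc
  set r : ℝ := (b - a) / 2 with hr
  set P := Q₁ * Q₁ᴴ with hP
  set M := A - (c : ℂ) • (1 : Matrix (Fin n) (Fin n) ℂ) with hM
  have hr0 : 0 ≤ r := by linarith
  have hPh : P.IsHermitian := isHermitian_mul_conjTranspose_self Q₁
  have hPP : P * P = P := by rw [hP, Matrix.mul_assoc, ← Matrix.mul_assoc Q₁ᴴ, h₁₁, Matrix.one_mul]
  have hMh : M.IsHermitian := by
    refine hA.sub ?_
    simp [IsHermitian, conjTranspose_smul]
  have hnorm := norm_mul_cfc_plateau_sq_mul_le hMh hPh hPP hbb hr0 hd hδ0 hδd hVδ.le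
  have htrace := trace_cfc_plateau hMh hPh hbb hr0 hd hδ0 hδd hVδ.le
  set E := cfc (plateau (r + δR) (r + d)) M with hE
  have hEh : E.IsHermitian := IsSelfAdjoint.cfc
  -- action of `M` and `E` on the columns of `Y`
  have hAY : A * Y = Y * diagonal fun i => (μ i : ℂ) := by
    rw [← hμ, ← mul_assoc, ← mul_assoc, hYY', one_mul]
  have hMY : ∀ i, toEuclideanCLM (𝕜 := ℂ) M (WithLp.toLp 2 (Y.col i)) =
      ((μ i - c : ℝ) : ℂ) • WithLp.toLp 2 (Y.col i) := fun i => by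
    apply WithLp.ofLp_injective 2
    ext j
    have h1 : (A * Y) j i = Y j i * μ i := by rw [hAY, mul_diagonal]
    have h2 : (A *ᵥ Y.col i) j = Y j i * μ i := h1
    simp only [toEuclideanCLM_toLp, hM, sub_mulVec, smul_mulVec, one_mulVec, Pi.sub_apply, h2,
      Pi.smul_apply, WithLp.ofLp_smul, col_apply, smul_eq_mul]
    push_cast; ring
  have hYne : ∀ i, WithLp.toLp 2 (Y.col i) ≠ 0 := fun i h0 => by
    have h1 : (Yᴴ * Y) i i = 0 := by
      rw [mul_apply]
      refine Finset.sum_eq_zero fun j _ => ?_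
      have : Y j i = 0 := congrFun (congrArg (WithLp.ofLp (p := 2)) h0) j
      rw [this, mul_zero]
    rw [hYY, one_apply_eq] at h1
    exact one_ne_zero h1
  have hdich := fun i =>
    plateau_zero_or_one_of_eigenvalue hbb hr0 hd hδ0 hδd hVδ.le (hYne i) (hMY i)
  have hEY : ∀ i j, (E * Y) j i = (plateau (r + δR) (r + d) (μ i - c) : ℂ) * Y j i := fun i j =>
    congrFun (congrArg (WithLp.ofLp (p := 2)) (cfc_apply_eigenvector hMh
      (plateau (r + δR) (r + d)) (hMY i))) j
  classical
  -- The trace of E, computed in the given eigenvectors, counts the inner ones; the homotopy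
  -- identified it with the trace of 1 - P, which is n - k.
  have hcard : Fintype.card {i // |μ i - c| ≤ r + δR} = n - k := by
    have h1 : E.trace = ∑ i, (plateau (r + δR) (r + d) (μ i - c) : ℂ) := by
      have : Yᴴ * (E * Y) = diagonal fun i => (plateau (r + δR) (r + d) (μ i - c) : ℂ) := by
        have h2 : E * Y = Y * diagonal fun i => (plateau (r + δR) (r + d) (μ i - c) : ℂ) := by
          ext j i; rw [hEY, mul_diagonal, mul_comm]
        rw [h2, ← mul_assoc, hYY, one_mul]
      rw [← trace_diagonal, ← this, trace_mul_comm, mul_assoc, hYY', mul_one]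
    have h2 : (1 - P).trace = ((n - k : ℕ) : ℂ) := by
      rw [trace_sub, hP, trace_mul_comm, h₁₁, trace_one, trace_one, Fintype.card_fin,
        Fintype.card_fin, Nat.cast_sub hkn.le]
    rw [htrace, h2] at h1
    have h3 : ∀ i, (plateau (r + δR) (r + d) (μ i - c) : ℂ) =
        if |μ i - c| ≤ r + δR then 1 else 0 := fun i => by
      rcases hdich i with ⟨h4, h5⟩ | ⟨h4, h5⟩
      · rw [h5, if_pos h4, Complex.ofReal_one]
      · rw [h5, if_neg (by linarith), Complex.ofReal_zero]
    simp only [h3, Finset.sum_boole] at h1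
    rw [Fintype.card_subtype]
    exact_mod_cast h1.symm
  obtain ⟨e, he₁, he₂⟩ := exists_sumEquiv_of_card hkn.le hcard
  set X₁ := Y.submatrix id (e ∘ Sum.inl) with hX₁
  set X₂ := Y.submatrix id (e ∘ Sum.inr) with hX₂
  have hX : fromCols X₁ X₂ = Y.submatrix id e := by
    ext i (j | j) <;> rfl
  have hXX : (fromCols X₁ X₂)ᴴ * fromCols X₁ X₂ = 1 := by
    rw [hX, conjTranspose_submatrix, submatrix_mul _ _ _ _ _ Function.bijective_id |>.symm, hYY,
      submatrix_one_equiv]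
  have hXX' : fromCols X₁ X₂ * (fromCols X₁ X₂)ᴴ = 1 := by
    rw [hX, conjTranspose_submatrix, submatrix_mul_equiv, hYY', submatrix_id_id]
  have hXAX : (fromCols X₁ X₂)ᴴ * A * fromCols X₁ X₂ =
      (diagonal fun i => (μ i : ℂ)).submatrix e e := by
    rw [hX, conjTranspose_submatrix, ← hμ]
    ext i j
    simp [mul_apply]
  have hX₁₁ : X₁ᴴ * X₁ = 1 := by
    have := hXX
    rw [conjTranspose_fromCols_eq_fromRows_conjTranspose, fromRows_mul_fromCols,
      ← fromBlocks_one, fromBlocks_inj] at this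
    exact this.1
  have hXsum : X₁ * X₁ᴴ + X₂ * X₂ᴴ = 1 := by
    rwa [conjTranspose_fromCols_eq_fromRows_conjTranspose, fromCols_mul_fromRows] at hXX'
  have hout : ∀ i, r + d ≤ |μ (e (Sum.inl i)) - c| := fun i =>
    ((hdich _).resolve_left fun h => he₁ i h.1).1
  have hEX₁ : E * X₁ = 0 := by
    ext j i
    have h1 : (E * X₁) j i = (E * Y) j (e (Sum.inl i)) := rfl
    rw [h1, hEY, ((hdich _).resolve_left fun h => he₁ i h.1).2, Complex.ofReal_zero, zero_mul]
    rfl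
  have hEX₂ : E * X₂ = X₂ := by
    ext j i
    have h1 : (E * X₂) j i = (E * Y) j (e (Sum.inr i)) := rfl
    rw [h1, hEY, plateau_eq_one (by linarith) (he₂ i), Complex.ofReal_one, one_mul]
    rfl
  have hEX : 1 - E = X₁ * X₁ᴴ := by
    have : E = X₂ * X₂ᴴ := by
      calc E = E * (X₁ * X₁ᴴ + X₂ * X₂ᴴ) := by rw [hXsum, mul_one]
        _ = X₂ * X₂ᴴ := by
          rw [mul_add, ← Matrix.mul_assoc, ← Matrix.mul_assoc, hEX₁, hEX₂, Matrix.zero_mul,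
            zero_add]
    rw [this, ← hXsum, add_sub_cancel_right]
  have hangle := largestPrincipalAngle_le_arctan hEh (by omega) h₁₁ hX₁₁ hEX (norm_nonneg R) hd
    hnorm
  have hlt := hangle.trans_lt (Real.arctan_lt_pi_div_two _)
  refine ⟨e, X₁, X₂, diagonal fun i => (μ (e (Sum.inl i)) : ℂ),
    diagonal fun i => (μ (e (Sum.inr i)) : ℂ), hX, hXX, hXX', ?_, isDiag_diagonal _,
    isDiag_diagonal _, ?_, ?_, hlt, ?_⟩
  · rw [hXAX, submatrix_diagonal_equiv, fromBlocks_diagonal]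
    congr 1
    ext1 (i | i) <;> rfl
  · rw [spectrum_diagonal]
    rintro _ ⟨i, rfl⟩
    refine ⟨_, ?_, rfl⟩
    rcases le_abs.1 (hout i) with h | h
    · right; rw [Set.mem_Ici]; linarith
    · left; rw [Set.mem_Iic]; linarith
  · rw [spectrum_diagonal]
    rintro _ ⟨i, rfl⟩
    refine ⟨_, ?_, rfl⟩
    have h := abs_le.1 (he₂ i)
    constructor <;> linarith [h.1, h.2]
  · rw [← Real.tan_arctan (‖R‖ / d)]
    refine Real.strictMonoOn_tan.monotoneOn ⟨?_, hlt⟩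
      ⟨Real.neg_pi_div_two_lt_arctan _, Real.arctan_lt_pi_div_two _⟩ hangle
    exact (neg_neg_of_pos (half_pos Real.pi_pos)).trans_le (Real.arccos_nonneg _)
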